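/- Let $K$ be a commutative ring, $n,m\ge 0$ integers, and let $P=K[y_1,\dots,y_m]$, $D=K[x_{ik}: 1\le i\le n,\ 1\le k\le m]$ and $A=K[\xi_{kij}: 1\le i,j\le n,\ 1\le k\le m]$ be polynomial rings. Let $\xi_k=(\xi_{kij})_{i,j}$ be the generic $n\times n$ matrices, and let $A_P$ be the quotient of $A$ by the ideal generated by the entries of all the matrices $\xi_k\xi_h-\xi_h\xi_k$. The group $G=\mathrm{GL}(n,K)$ acts on $A$ by $K$-algebra automorphisms, $g\in G$ mapping $\xi_{kij}$ to the $(i,j)$ entry of $g^{-1}\xi_k g$, and hence on $A_P$; let $A^G$ and $A_P^G$ be the rings of invariants. Let $\Delta:A\to D$ be the $K$-algebra homomorphism mapping $\xi_{kij}$ to $0$ if $i\ne j$ and $\xi_{kii}$ to $x_{ik}$, and let $\Delta':A_P\to D$ be the homomorphism induced by it. Let $D\cong P^{\otimes n}$ be the isomorphism mapping $x_{ik}$ to $1^{\otimes (i-1)}\otimes y_k\otimes 1^{\otimes (n-i)}$. For a commutative $K$-algebra $B$ let $\mathrm{TS}^nB$ be the subalgebra of $B^{\otimes n}$ (tensor product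 over $K$) of elements invariant under the symmetric group $\mathfrak S_n$ permuting the factors. Let $I$ be an ideal of $P$ and let $R\cong P/I$ be a $K$-algebra that is flat as a $K$-module, with the resulting surjection $\pi:P\to R$. Then there are surjective $K$-algebra homomorphisms $A^G\to \mathrm{TS}^nR$ and $A_P^G\to\mathrm{TS}^nR$. More precisely, the composites $$A\xrightarrow{\ \Delta\ }D\cong P^{\otimes n}\xrightarrow{\ \pi^{\otimes n}\ }R^{\otimes n},\qquad A_P\xrightarrow{\ \Delta'\ }D\cong P^{\otimes n}\xrightarrow{\ \pi^{\otimes n}\ }R^{\otimes n}$$ restrict to surjective $K$-algebra homomorphisms $A^G\to\mathrm{TS}^nR$ and $A_P^G\to \mathrm{TS}^nR$. -/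

import Mathlib

open scoped TensorProduct

noncomputable section

namespace GenericMatrices

/-- The polynomial ring `P = K[y_1, …, y_m]`. -/
abbrev P (K : Type*) [CommRing K] (m : ℕ) : Type _ := MvPolynomial (Fin m) K

/-- The polynomial ring `A = K[ξ_{kij}]`, the variable `ξ_{kij}` being indexed by `(k, i, j)`. -/
abbrev A (K : Type*) [CommRing K] (n m : ℕ) : Type _ :=
  MvPolynomial (Fin m × Fin n × Fin n) K

/-- The polynomial ring `D = K[x_{ik}]`, the variable `x_{ik}` being indexed by `(i, k)`. -/
abbrev D (K : Type*) [CommRing K] (n m : ℕ) : Type _ := MvPolynomial (Fin n × Fin m) K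

/-- The generic matrix `ξ_k`. -/
def generic (K : Type*) [CommRing K] (n m : ℕ) (k : Fin m) :
    Matrix (Fin n) (Fin n) (A K n m) :=
  Matrix.of fun i j => MvPolynomial.X (k, i, j)

/-- The ideal of `A` generated by the entries of all the commutators `ξ_k ξ_h - ξ_h ξ_k`. -/
def commIdeal (K : Type*) [CommRing K] (n m : ℕ) : Ideal (A K n m) :=
  Ideal.span {a | ∃ (k h : Fin m) (i j : Fin n),
    a = (generic K n m k * generic K n m h - generic K n m h * generic K n m k) i j}

/-- The coordinate ring `A_P` of the commuting scheme. -/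
abbrev AP (K : Type*) [CommRing K] (n m : ℕ) : Type _ := A K n m ⧸ commIdeal K n m

/-- The matrix `g⁻¹ ξ_k g`. -/
def conjGeneric (K : Type*) [CommRing K] (n m : ℕ) (g : GL (Fin n) K) (k : Fin m) :
    Matrix (Fin n) (Fin n) (A K n m) :=
  (((g⁻¹ : GL (Fin n) K) : Matrix (Fin n) (Fin n) K).map (algebraMap K (A K n m))) *
    generic K n m k * ((g : Matrix (Fin n) (Fin n) K).map (algebraMap K (A K n m)))

/-- The action of `g ∈ GL(n, K)` on `A`: it maps `ξ_{kij}` to the `(i, j)` entry of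
`g⁻¹ ξ_k g`. -/
def act (K : Type*) [CommRing K] (n m : ℕ) (g : GL (Fin n) K) : A K n m →ₐ[K] A K n m :=
  MvPolynomial.aeval fun v => conjGeneric K n m g v.1 v.2.1 v.2.2

theorem map_act_generic (K : Type*) [CommRing K] (n m : ℕ) (g : GL (Fin n) K) (k : Fin m) :
    (generic K n m k).map (act K n m g) = conjGeneric K n m g k := by
  ext1 i j
  simp [generic, act]

theorem conjGeneric_mul (K : Type*) [CommRing K] (n m : ℕ) (g : GL (Fin n) K) (k h : Fin m) :
    conjGeneric K n m g k * conjGeneric K n m g h =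
      (((g⁻¹ : GL (Fin n) K) : Matrix (Fin n) (Fin n) K).map (algebraMap K (A K n m))) *
        (generic K n m k * generic K n m h) *
        ((g : Matrix (Fin n) (Fin n) K).map (algebraMap K (A K n m))) := by
  have key : ((g : Matrix (Fin n) (Fin n) K).map (algebraMap K (A K n m))) *
      (((g⁻¹ : GL (Fin n) K) : Matrix (Fin n) (Fin n) K).map (algebraMap K (A K n m))) = 1 := by
    rw [← Matrix.map_mul, ← Units.val_mul, mul_inv_cancel, Units.val_one]
    exact Matrix.map_one _ (map_zero _) (map_one _)
  unfold conjGeneric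
  generalize ((g : Matrix (Fin n) (Fin n) K).map (algebraMap K (A K n m))) = u at *
  generalize (((g⁻¹ : GL (Fin n) K) : Matrix (Fin n) (Fin n) K).map
    (algebraMap K (A K n m))) = v at *
  calc v * generic K n m k * u * (v * generic K n m h * u)
      = v * generic K n m k * (u * v) * generic K n m h * u := by simp only [mul_assoc]
    _ = _ := by rw [key]; simp only [mul_assoc, mul_one]

theorem commIdeal_le_comap_act (K : Type*) [CommRing K] (n m : ℕ) (g : GL (Fin n) K) :
    commIdeal K n m ≤ (commIdeal K n m).comap (act K n m g) := by
  unfold commIdeal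
  rw [Ideal.span_le]
  rintro _ ⟨k, h, i, j, rfl⟩
  have e : act K n m g
      ((generic K n m k * generic K n m h - generic K n m h * generic K n m k) i j) =
      ((((g⁻¹ : GL (Fin n) K) : Matrix (Fin n) (Fin n) K).map (algebraMap K (A K n m))) *
        (generic K n m k * generic K n m h - generic K n m h * generic K n m k) *
        ((g : Matrix (Fin n) (Fin n) K).map (algebraMap K (A K n m)))) i j := by
    rw [mul_sub, sub_mul, ← conjGeneric_mul, ← conjGeneric_mul,
      ← map_act_generic, ← map_act_generic]
    simp [Matrix.mul_apply]
  change act K n m g _ ∈ Ideal.span _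
  rw [e, Matrix.mul_apply]
  refine Ideal.sum_mem _ fun b _ => Ideal.mul_mem_right _ _ ?_
  rw [Matrix.mul_apply]
  exact Ideal.sum_mem _ fun a _ =>
    Ideal.mul_mem_left _ _ (Ideal.subset_span ⟨k, h, a, b, rfl⟩)

/-- The induced action of `g ∈ GL(n, K)` on `A_P`. -/
def actP (K : Type*) [CommRing K] (n m : ℕ) (g : GL (Fin n) K) : AP K n m →ₐ[K] AP K n m :=
  Ideal.quotientMapₐ (commIdeal K n m) (act K n m g) (commIdeal_le_comap_act K n m g)

/-- The ring of invariants `A^G`, `G = GL(n, K)`. -/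
def invA (K : Type*) [CommRing K] (n m : ℕ) : Subalgebra K (A K n m) :=
  ⨅ g : GL (Fin n) K, AlgHom.equalizer (act K n m g) (AlgHom.id K (A K n m))

/-- The ring of invariants `A_P^G`, `G = GL(n, K)`. -/
def invAP (K : Type*) [CommRing K] (n m : ℕ) : Subalgebra K (AP K n m) :=
  ⨅ g : GL (Fin n) K, AlgHom.equalizer (actP K n m g) (AlgHom.id K (AP K n m))

/-- The homomorphism `Δ : A → D` mapping `ξ_{kij}` to `0` if `i ≠ j` and `ξ_{kii}` to
`x_{ik}`. -/
def diag (K : Type*) [CommRing K] (n m : ℕ) : A K n m →ₐ[K] D K n m :=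
  MvPolynomial.aeval fun v =>
    if v.2.1 = v.2.2 then MvPolynomial.X (v.2.1, v.1) else 0

theorem diag_eq_zero (K : Type*) [CommRing K] (n m : ℕ) (a : A K n m)
    (ha : a ∈ commIdeal K n m) : diag K n m a = 0 := by
  have hd : ∀ k, (generic K n m k).map (diag K n m) =
      Matrix.diagonal fun i => (MvPolynomial.X (i, k) : D K n m) := by
    intro k
    ext1 i j
    simp [generic, diag, Matrix.diagonal_apply]
  suffices commIdeal K n m ≤ RingHom.ker (diag K n m) from this ha
  unfold commIdeal
  rw [Ideal.span_le]
  rintro _ ⟨k, h, i, j, rfl⟩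
  change diag K n m _ = 0
  have e : diag K n m
      ((generic K n m k * generic K n m h - generic K n m h * generic K n m k) i j) =
      ((generic K n m k).map (diag K n m) * (generic K n m h).map (diag K n m) -
        (generic K n m h).map (diag K n m) * (generic K n m k).map (diag K n m)) i j := by
    simp [Matrix.mul_apply]
  rw [e, hd, hd, Matrix.diagonal_mul_diagonal, Matrix.diagonal_mul_diagonal]
  simp [mul_comm]

/-- The homomorphism `Δ' : A_P → D` through which `Δ` factors. -/
def diagP (K : Type*) [CommRing K] (n m : ℕ) : AP K n m →ₐ[K] D K n m :=
  Ideal.Quotient.liftₐ (commIdeal K n m) (diag K n m) (diag_eq_zero K n m)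

/-- The homomorphism (in fact isomorphism) `D → P^{⊗ n}` mapping `x_{ik}` to
`1 ⊗ ⋯ ⊗ y_k ⊗ ⋯ ⊗ 1`, with `y_k` in position `i`. -/
def toTensor (K : Type*) [CommRing K] (n m : ℕ) :
    D K n m →ₐ[K] ⨂[K] _ : Fin n, P K m :=
  MvPolynomial.aeval fun v =>
    PiTensorProduct.singleAlgHom (R := K) (A := fun _ : Fin n => P K m) v.1
      (MvPolynomial.X v.2)

theorem reindex_mul (K : Type*) [CommRing K] (n : ℕ) (B : Type*) [CommRing B] [Algebra K B]
    (σ : Equiv.Perm (Fin n)) (x y : ⨂[K] _ : Fin n, B) :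
    PiTensorProduct.reindex K (fun _ => B) σ (x * y) =
      PiTensorProduct.reindex K (fun _ => B) σ x *
        PiTensorProduct.reindex K (fun _ => B) σ y := by
  induction x using PiTensorProduct.induction_on with
  | add a b ha hb => simp only [add_mul, map_add, ha, hb]
  | smul_tprod r a =>
    induction y using PiTensorProduct.induction_on with
    | add c d hc hd => simp only [mul_add, map_add, hc, hd]
    | smul_tprod s c =>
      rw [PiTensorProduct.smul_tprod_mul_smul_tprod, map_smul, map_smul, map_smul,
        PiTensorProduct.reindex_tprod, PiTensorProduct.reindex_tprod,
        PiTensorProduct.reindex_tprod, PiTensorProduct.smul_tprod_mul_smul_tprod]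
      rfl

/-- The algebra `TS^n B` of symmetric tensors: the invariants of `B^{⊗ n}` under the symmetric
group permuting the factors. -/
def TS (K : Type*) [CommRing K] (n : ℕ) (B : Type*) [CommRing B] [Algebra K B] :
    Subalgebra K (⨂[K] _ : Fin n, B) where
  carrier := {z | ∀ σ : Equiv.Perm (Fin n), PiTensorProduct.reindex K (fun _ => B) σ z = z}
  mul_mem' {x y} hx hy σ := by rw [reindex_mul, hx σ, hy σ]
  add_mem' {x y} hx hy σ := by rw [map_add, hx σ, hy σ]
  algebraMap_mem' r σ := by
    rw [Algebra.algebraMap_eq_smul_one, map_smul, PiTensorProduct.one_def,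
      PiTensorProduct.reindex_tprod]
    rfl

end GenericMatrices

end

/-!
The composite `A → D ≅ P^{⊗ n}` sends the action of a permutation matrix on `A` to the permutation
of the tensor factors (`toTensor_diag_act_permGL`). Since `GL(n, K)` contains the permutation
matrices, invariants of `A` or of `A_P` go to symmetric tensors. An invariant of `A` yields one of
`A_P` with the same image in `D`, so both surjectivity claims follow from the one for `A`, which
splits into two independent facts.

*`A^G → TS^n P` is onto* (`exists_invA_toTensor_diag_eq`). For a monomial `μ` in `y_1, …, y_m`, the
coefficients of the characteristic polynomial of `-μ(ξ_1, …, ξ_m)` are invariant, and they go to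
the elementary symmetric tensors `e_k(μ)`, i.e. the elementary symmetric functions of the `n`
copies of `μ` in `P^{⊗ n}` (`toTensor_diag_charpoly_coeff`). These generate `TS^n P`
(`TS_le_of_elemSym_mem`): the tensors of monomials form a basis of `P^{⊗ n}`, and a symmetric tensor
has coefficients that depend only on the multiset `T` of nontrivial monomials occurring in the
basis tensor. Among the basis tensors with at least `|T|` nontrivial factors, those occurring in
`∏_{μ ∈ T} e_{T(μ)}(μ)` (product over distinct `μ`, with `T(μ)` the multiplicity) are exactly those
of type `T`, each with coefficient `1` (`repr_prod_elemSym`). Subtracting combinations of such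
products lowers the number of nontrivial factors, and induction applies. No division is needed, so
`K` is arbitrary.

*`TS^n P → TS^n R` is onto* (`exists_symmetric_lift`). Lift a symmetric tensor to any
`w ∈ P^{⊗ n}`. The finitely many differences `σ w - w` lie in the kernel of `P^{⊗ n} → R^{⊗ n}`,
which is spanned by pure tensors with a factor in the kernel of `π : P → R`. As `P` is free and `R`
is flat, the equational criterion for flatness provides an endomorphism `ψ` of `P` with `π ψ = π`
that kills all the factors involved (`exists_endomorphism_map_eq_zero`). Then `ψ^{⊗ n} w` is
symmetric and still maps to the given tensor.
-/

noncomputable section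

namespace GenericMatrices

/-! ### Lifting symmetric tensors to a free cover of a flat module -/

section FlatLifting

variable {K F M : Type*} [CommRing K] [AddCommGroup F] [Module K F] [AddCommGroup M] [Module K M]

/-- The kernel of a surjection `π` from a free module onto a flat module is locally a direct
summand: each of its elements is killed by an endomorphism of the free module which induces the
identity on the quotient. -/
theorem exists_endomorphism_apply_eq_zero [Module.Free K F] [Module.Flat K M] {π : F →ₗ[K] M}
    (hπ : Function.Surjective π) {x : F} (hx : π x = 0) :
    ∃ ψ : F →ₗ[K] F, π ∘ₗ ψ = π ∧ ψ x = 0 := by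
  classical
  let b := Module.Free.chooseBasis K F
  -- The equational criterion applies to the finitely many coordinates occurring in `x`.
  let s := (b.repr x).support
  let x₀ : s → K := fun i => b.repr x i
  let ι : (s → K) →ₗ[K] F := Fintype.linearCombination K fun i : s => b i
  have hι : ι x₀ = x := by
    conv_rhs => rw [← b.linearCombination_repr x, Finsupp.linearCombination_apply, Finsupp.sum]
    exact Finset.sum_coe_sort s fun i => b.repr x i • b i
  obtain ⟨k, a, y, hya, ha⟩ := Module.Flat.exists_factorization_of_apply_eq_zero_of_free
    (x := π ∘ₗ ι) (f := x₀) (by simp [hι, hx])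
  obtain ⟨y', hy'⟩ := Module.projective_lifting_property π y hπ
  -- `ψ` follows the lifted factorization on the basis vectors occurring in `x` and fixes the others.
  let ψ : F →ₗ[K] F :=
    b.constr K fun i => if h : i ∈ s then y' (a (Pi.single ⟨i, h⟩ 1)) else b i
  have hψ : ψ ∘ₗ ι = y' ∘ₗ a := by
    refine LinearMap.pi_ext' fun i => LinearMap.ext_ring ?_
    simp [ι, ψ, Fintype.linearCombination_apply_single]
  refine ⟨ψ, b.ext fun i => ?_, ?_⟩
  · by_cases h : i ∈ s
    · have := LinearMap.congr_fun hya (Pi.single ⟨i, h⟩ 1)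
      rw [← hy'] at this
      simpa [ψ, h, ι, Fintype.linearCombination_apply_single] using this.symm
    · simp [ψ, h]
  · rw [← hι, ← LinearMap.comp_apply, hψ, LinearMap.comp_apply, ha, map_zero]

theorem exists_endomorphism_forall_apply_eq_zero [Module.Free K F] [Module.Flat K M]
    {π : F →ₗ[K] M} (hπ : Function.Surjective π) (s : Finset F) (hs : ∀ x ∈ s, π x = 0) :
    ∃ ψ : F →ₗ[K] F, π ∘ₗ ψ = π ∧ ∀ x ∈ s, ψ x = 0 := by
  classical
  induction s using Finset.induction_on with
  | empty => exact ⟨LinearMap.id, by simp, by simp⟩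
  | insert x s _ ih =>
    obtain ⟨ψ, h₁, h₂⟩ := ih fun y hy => hs y (Finset.mem_insert_of_mem hy)
    obtain ⟨θ, h₃, h₄⟩ := exists_endomorphism_apply_eq_zero hπ (x := ψ x) <| by
      rw [← LinearMap.comp_apply, h₁, hs x (Finset.mem_insert_self x s)]
    refine ⟨θ ∘ₗ ψ, by rw [← LinearMap.comp_assoc, h₃, h₁], fun y hy => ?_⟩
    rcases Finset.mem_insert.1 hy with rfl | hy
    · exact h₄
    · simp [h₂ y hy]

variable {ι : Type*} [Fintype ι]

/-- Modulo the pure tensors with a factor in `ker π`, a pure tensor `⨂ f i` depends only on the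
images `π (f i)`; the factors are exchanged one at a time. -/
theorem tprod_sub_tprod_mem {J : Submodule K (⨂[K] _ : ι, F)} {π : F →ₗ[K] M}
    (hJ : ∀ f : ι → F, (∃ i, π (f i) = 0) → PiTensorProduct.tprod K f ∈ J) {f g : ι → F}
    (hfg : ∀ i, π (f i) = π (g i)) :
    PiTensorProduct.tprod K f - PiTensorProduct.tprod K g ∈ J := by
  classical
  suffices ∀ s : Finset ι, PiTensorProduct.tprod K (s.piecewise f g) -
      PiTensorProduct.tprod K g ∈ J by simpa using this Finset.univ
  intro s
  induction s using Finset.induction_on with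
  | empty => simp
  | insert i s hi ih =>
    have hg : s.piecewise f g = Function.update (s.piecewise f g) i (g i) := by
      rw [Function.eq_update_iff]; simp [hi]
    rw [← sub_add_sub_cancel _ (PiTensorProduct.tprod K (s.piecewise f g))]
    refine J.add_mem ?_ ih
    rw [Finset.piecewise_insert]
    nth_rw 2 [hg]
    rw [← MultilinearMap.map_update_sub]
    exact hJ _ ⟨i, by simp [hfg i]⟩

/-- Right exactness: the kernel of `π^{⊗ ι}` is generated by the pure tensors with a factor in
`ker π`. Since the class of `⨂ f i` modulo these depends only on the `π (f i)`, the quotient map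
factors through `π^{⊗ ι}`. -/
theorem ker_map_le {π : F →ₗ[K] M} (hπ : Function.Surjective π)
    {J : Submodule K (⨂[K] _ : ι, F)}
    (hJ : ∀ f : ι → F, (∃ i, π (f i) = 0) → PiTensorProduct.tprod K f ∈ J) :
    LinearMap.ker (PiTensorProduct.map fun _ : ι => π) ≤ J := by
  have hs := Function.rightInverse_surjInv hπ
  set s := Function.surjInv hπ
  have key : ∀ f g : ι → F, (∀ i, π (f i) = π (g i)) →
      J.mkQ (PiTensorProduct.tprod K f) = J.mkQ (PiTensorProduct.tprod K g) := fun f g h => by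
    rw [← sub_eq_zero, ← map_sub]
    exact (Submodule.Quotient.mk_eq_zero J).2 (tprod_sub_tprod_mem hJ h)
  let L : MultilinearMap K (fun _ : ι => M) ((⨂[K] _ : ι, F) ⧸ J) :=
    { toFun := fun r => J.mkQ (PiTensorProduct.tprod K (s ∘ r))
      map_update_add' := by
        intro _ r i x y
        have e : ∀ z, (s ∘ Function.update r i z) = Function.update (s ∘ r) i (s z) := fun z => by
          rw [Function.comp_update]
        rw [e, e, e, ← map_add, ← MultilinearMap.map_update_add]
        refine key _ _ fun j => ?_
        rcases eq_or_ne j i with rfl | h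
        · simp [hs _]
        · simp [h]
      map_update_smul' := by
        intro _ r i c x
        have e : ∀ z, (s ∘ Function.update r i z) = Function.update (s ∘ r) i (s z) := fun z => by
          rw [Function.comp_update]
        rw [e, e, ← map_smul, ← MultilinearMap.map_update_smul]
        refine key _ _ fun j => ?_
        rcases eq_or_ne j i with rfl | h
        · simp [hs _]
        · simp [h] }
  have hL : PiTensorProduct.lift L ∘ₗ (PiTensorProduct.map fun _ : ι => π) = J.mkQ := by
    refine PiTensorProduct.ext (MultilinearMap.ext fun f => ?_)
    simp only [LinearMap.compMultilinearMap_apply, LinearMap.comp_apply,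
      PiTensorProduct.map_tprod, PiTensorProduct.lift.tprod]
    exact key _ _ fun i => hs _
  rw [← Submodule.ker_mkQ J, ← hL]
  exact LinearMap.ker_le_ker_comp _ _

/-- Finitely many tensors killed by `π^{⊗ ι}` are killed by `ψ^{⊗ ι}` for a single endomorphism
`ψ` of the free module with `π ψ = π`. -/
theorem exists_endomorphism_map_eq_zero [Module.Free K F] [Module.Flat K M]
    {π : F →ₗ[K] M} (hπ : Function.Surjective π) (t : Finset (⨂[K] _ : ι, F))
    (ht : ∀ w ∈ t, PiTensorProduct.map (fun _ : ι => π) w = 0) :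
    ∃ ψ : F →ₗ[K] F, π ∘ₗ ψ = π ∧ ∀ w ∈ t, PiTensorProduct.map (fun _ : ι => ψ) w = 0 := by
  classical
  -- A tensor lies in `J` if it is killed by `ψ^{⊗ ι}` as soon as `ψ` kills suitable finitely many
  -- elements of `ker π`.
  let J : Submodule K (⨂[K] _ : ι, F) :=
    { carrier := {w | ∃ s : Finset F, (∀ x ∈ s, π x = 0) ∧ ∀ ψ : F →ₗ[K] F,
        (∀ x ∈ s, ψ x = 0) → PiTensorProduct.map (fun _ : ι => ψ) w = 0}
      zero_mem' := ⟨∅, by simp, by simp⟩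
      add_mem' := by
        rintro a b ⟨s, hs, ha⟩ ⟨u, hu, hb⟩
        refine ⟨s ∪ u, fun x hx => (Finset.mem_union.1 hx).elim (hs x) (hu x), fun ψ hψ => ?_⟩
        rw [map_add, ha ψ fun x hx => hψ x (Finset.mem_union_left _ hx),
          hb ψ fun x hx => hψ x (Finset.mem_union_right _ hx), add_zero]
      smul_mem' := by
        rintro c a ⟨s, hs, ha⟩
        exact ⟨s, hs, fun ψ hψ => by rw [map_smul, ha ψ hψ, smul_zero]⟩ }
  have hJ : LinearMap.ker (PiTensorProduct.map fun _ : ι => π) ≤ J := by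
    refine ker_map_le hπ ?_
    rintro f ⟨i, hi⟩
    refine ⟨{f i}, by simpa using hi, fun ψ hψ => ?_⟩
    rw [PiTensorProduct.map_tprod]
    exact MultilinearMap.map_coord_zero _ i (hψ _ (Finset.mem_singleton_self _))
  choose! s hs hs' using fun w (hw : w ∈ t) => hJ (ht w hw)
  obtain ⟨ψ, h₁, h₂⟩ := exists_endomorphism_forall_apply_eq_zero hπ (t.biUnion s)
    (by simpa using fun x w hw hx => hs w hw x hx)
  exact ⟨ψ, h₁, fun w hw => hs' w hw ψ fun x hx => h₂ x (Finset.mem_biUnion.2 ⟨w, hw, hx⟩)⟩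

/-- A symmetric tensor over a flat quotient of a free module lifts to a symmetric tensor over the
free module. -/
theorem exists_symmetric_lift [Module.Free K F] [Module.Flat K M]
    {π : F →ₗ[K] M} (hπ : Function.Surjective π) {z : ⨂[K] _ : ι, M}
    (hz : ∀ σ : Equiv.Perm ι, PiTensorProduct.reindex K (fun _ => M) σ z = z) :
    ∃ w : ⨂[K] _ : ι, F, (∀ σ : Equiv.Perm ι, PiTensorProduct.reindex K (fun _ => F) σ w = w) ∧
      PiTensorProduct.map (fun _ => π) w = z := by
  classical
  obtain ⟨w, rfl⟩ : ∃ w, PiTensorProduct.map (fun _ : ι => π) w = z := by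
    clear hz
    induction z using PiTensorProduct.induction_on with
    | smul_tprod c f =>
      refine ⟨c • PiTensorProduct.tprod K fun i => Function.surjInv hπ (f i), ?_⟩
      simp [Function.surjInv_eq hπ]
    | add x y hx hy =>
      obtain ⟨⟨x, rfl⟩, ⟨y, rfl⟩⟩ := And.intro hx hy
      exact ⟨x + y, map_add _ x y⟩
  obtain ⟨ψ, h₁, h₂⟩ := exists_endomorphism_map_eq_zero hπ
    (Finset.univ.image fun σ : Equiv.Perm ι => PiTensorProduct.reindex K (fun _ => F) σ w - w) <| by
      simp only [Finset.mem_image, Finset.mem_univ, true_and, forall_exists_index,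
        forall_apply_eq_imp_iff]
      intro σ
      rw [map_sub, sub_eq_zero]
      exact (PiTensorProduct.map_reindex (fun _ => π) σ w).trans (hz σ)
  refine ⟨PiTensorProduct.map (fun _ => ψ) w, fun σ => ?_, ?_⟩
  · rw [← PiTensorProduct.map_reindex (fun _ : ι => ψ) σ w, ← sub_eq_zero, ← map_sub]
    exact h₂ _ (Finset.mem_image_of_mem _ (Finset.mem_univ σ))
  · rw [← LinearMap.comp_apply, ← PiTensorProduct.map_comp, h₁]

end FlatLifting

/-! ### Generators of the algebra of symmetric tensors -/

section SymmetricTensors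

variable {K : Type*} [CommRing K] {n m : ℕ}

/-- The tensor `y^{g 0} ⊗ ⋯ ⊗ y^{g (n - 1)}` of monomials with exponents `g i`. -/
def monomialTensor (K : Type*) [CommRing K] {n m : ℕ} (g : Fin n → Fin m →₀ ℕ) :
    ⨂[K] _ : Fin n, P K m :=
  PiTensorProduct.tprod K fun i => MvPolynomial.monomial (g i) 1

/-- The basis of `P^{⊗ n}` consisting of the tensors of monomials. -/
def monomialBasis (K : Type*) [CommRing K] (n m : ℕ) :
    Module.Basis (Fin n → Fin m →₀ ℕ) K (⨂[K] _ : Fin n, P K m) :=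
  Basis.piTensorProduct fun _ => MvPolynomial.basisMonomials (Fin m) K

theorem monomialBasis_apply (g : Fin n → Fin m →₀ ℕ) :
    monomialBasis K n m g = monomialTensor K g := by
  simp [monomialBasis, monomialTensor]

theorem monomialBasis_repr_monomialTensor (g h : Fin n → Fin m →₀ ℕ) :
    (monomialBasis K n m).repr (monomialTensor K g) h = if g = h then 1 else 0 := by
  rw [← monomialBasis_apply, Module.Basis.repr_self, Finsupp.single_apply]

theorem prod_monomialTensor {κ : Type*} (s : Finset κ) (g : κ → Fin n → Fin m →₀ ℕ) :
    ∏ a ∈ s, monomialTensor K (g a) = monomialTensor K (∑ a ∈ s, g a) := by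
  simp only [monomialTensor]
  rw [← PiTensorProduct.tprod_prod]
  congr 1
  ext1 i
  rw [Finset.prod_apply, Finset.sum_apply, MvPolynomial.monomial_sum_one]

theorem monomialBasis_repr_reindex (σ : Equiv.Perm (Fin n)) (z : ⨂[K] _ : Fin n, P K m)
    (g : Fin n → Fin m →₀ ℕ) :
    (monomialBasis K n m).repr (PiTensorProduct.reindex K (fun _ => P K m) σ z) g =
      (monomialBasis K n m).repr z (g ∘ σ) := by
  suffices h : Finsupp.lapply g ∘ₗ (monomialBasis K n m).repr.toLinearMap ∘ₗ
      (PiTensorProduct.reindex K (fun _ => P K m) σ).toLinearMap =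
      Finsupp.lapply (g ∘ σ) ∘ₗ (monomialBasis K n m).repr.toLinearMap from LinearMap.congr_fun h z
  refine (monomialBasis K n m).ext fun f => ?_
  have e : PiTensorProduct.reindex K (fun _ => P K m) σ (monomialTensor K f) =
      monomialTensor K (f ∘ σ.symm) := PiTensorProduct.reindex_tprod _ _
  simp only [LinearMap.comp_apply, LinearEquiv.coe_coe, Finsupp.lapply_apply, monomialBasis_apply,
    e, monomialBasis_repr_monomialTensor]
  congr 1
  exact propext (Equiv.comp_symm_eq σ g f)

/-- The elementary symmetric tensor `e_k(y^v)`: the sum over the `k`-element sets `s` of positions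
of the tensors with `y^v` at the positions in `s` and `1` elsewhere. It is the `k`-th elementary
symmetric function of the `n` copies of `y^v` in `P^{⊗ n}`, and it vanishes for `k > n`. -/
def elemSym (K : Type*) [CommRing K] (n : ℕ) {m : ℕ} (k : ℕ) (v : Fin m →₀ ℕ) :
    ⨂[K] _ : Fin n, P K m :=
  ∑ s ∈ Finset.univ.powersetCard k, monomialTensor K fun i => if i ∈ s then v else 0

/-- The multiset of the nonzero exponents among `g 0, …, g (n - 1)`. It determines the orbit of `g`
under permutations, and its cardinality is the number of nontrivial factors of `monomialTensor`. -/
def orbitType (g : Fin n → Fin m →₀ ℕ) : Multiset (Fin m →₀ ℕ) :=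
  (Finset.univ.val.map g).filter (· ≠ 0)

theorem zero_notMem_orbitType (g : Fin n → Fin m →₀ ℕ) : 0 ∉ orbitType g := by
  simp [orbitType]

theorem count_orbitType (g : Fin n → Fin m →₀ ℕ) {v : Fin m →₀ ℕ} (hv : v ≠ 0) :
    (orbitType g).count v = (Finset.univ.filter fun i => g i = v).card := by
  rw [orbitType, Multiset.count_filter_of_pos (p := (· ≠ 0)) hv, Multiset.count_map]
  simp only [eq_comm (a := v)]
  rfl

theorem card_orbitType (g : Fin n → Fin m →₀ ℕ) :
    (orbitType g).card = (Finset.univ.filter fun i => g i ≠ 0).card := by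
  rw [orbitType, Multiset.filter_map, Multiset.card_map]
  rfl

theorem exists_perm_of_orbitType_eq {f g : Fin n → Fin m →₀ ℕ} (h : orbitType f = orbitType g) :
    ∃ σ : Equiv.Perm (Fin n), f ∘ σ = g := by
  have hc : ∀ v, Fintype.card {i // g i = v} = Fintype.card {i // f i = v} := fun v => by
    rw [Fintype.card_subtype, Fintype.card_subtype]
    -- The multiplicity of `0` is not recorded in the type; it is `n` minus the cardinality.
    rcases eq_or_ne v 0 with rfl | hv
    · have h₁ := Finset.card_filter_add_card_filter_not (s := Finset.univ) fun i => f i = 0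
      have h₂ := Finset.card_filter_add_card_filter_not (s := Finset.univ) fun i => g i = 0
      have h₃ := congrArg Multiset.card h
      rw [card_orbitType, card_orbitType] at h₃
      simp only [ne_eq] at h₃
      omega
    · rw [← count_orbitType _ hv, ← count_orbitType _ hv, h]
  let e v := Fintype.equivOfCardEq (hc v)
  exact ⟨Equiv.ofFiberEquiv e, funext fun i => Equiv.ofFiberEquiv_map e i⟩

/-- The exponents of the product, over `v ∈ V`, of the tensors with `y^v` at the positions in `p v`
and `1` elsewhere: at `i` it is the sum of the `v` with `i ∈ p v`. -/
def superpose {V : Finset (Fin m →₀ ℕ)} (p : V → Finset (Fin n)) : Fin n → Fin m →₀ ℕ :=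
  ∑ v : V, fun i => if i ∈ p v then (v : Fin m →₀ ℕ) else 0

theorem superpose_apply {V : Finset (Fin m →₀ ℕ)} (p : V → Finset (Fin n)) (i : Fin n) :
    superpose p i = ∑ v : V, if i ∈ p v then (v : Fin m →₀ ℕ) else 0 :=
  Finset.sum_apply _ _ _

theorem prod_elemSym (V : Finset (Fin m →₀ ℕ)) (k : (Fin m →₀ ℕ) → ℕ) :
    ∏ v ∈ V, elemSym K n (k v) v =
      ∑ p ∈ Fintype.piFinset fun v : V => (Finset.univ : Finset (Fin n)).powersetCard (k v),
        monomialTensor K (superpose p) := by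
  rw [← Finset.prod_coe_sort]
  simp only [elemSym]
  rw [Finset.prod_univ_sum]
  exact Finset.sum_congr rfl fun p _ => prod_monomialTensor _ _

theorem support_superpose_subset {V : Finset (Fin m →₀ ℕ)} (p : V → Finset (Fin n)) :
    (Finset.univ.filter fun i => superpose p i ≠ 0) ⊆ Finset.univ.biUnion p := by
  intro i hi
  by_contra h
  refine (Finset.mem_filter.1 hi).2 ?_
  rw [superpose_apply]
  refine Finset.sum_eq_zero fun v _ => if_neg fun hv => h ?_
  exact Finset.mem_biUnion.2 ⟨v, Finset.mem_univ v, hv⟩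

/-- A superposition has at most `∑ |p v|` nontrivial positions, because each lies in some `p v`. -/
theorem card_orbitType_superpose_le {V : Finset (Fin m →₀ ℕ)} (p : V → Finset (Fin n)) :
    (orbitType (superpose p)).card ≤ ∑ v, (p v).card := by
  rw [card_orbitType]
  exact (Finset.card_le_card (support_superpose_subset p)).trans Finset.card_biUnion_le

/-- If a superposition has the maximal number `∑ |p v|` of nontrivial positions, then the sets `p v`
are disjoint, and `p v` is recovered as the set of positions where the exponent is `v`. -/
theorem eq_fiber_of_le_card_orbitType {V : Finset (Fin m →₀ ℕ)} (hV : 0 ∉ V)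
    {p : V → Finset (Fin n)}
    (hw : ∑ v, (p v).card ≤ (orbitType (superpose p)).card) (v : V) :
    p v = Finset.univ.filter fun i => superpose p i = v := by
  classical
  rw [card_orbitType] at hw
  -- The projection of the disjoint union of the `p v` to the positions preserves cardinality,
  -- hence is injective.
  have hcard : ((Finset.univ.sigma p).image fun x => x.2).card = (Finset.univ.sigma p).card := by
    refine le_antisymm Finset.card_image_le ?_
    rw [Finset.card_sigma]
    refine hw.trans (Finset.card_le_card ((support_superpose_subset p).trans fun i hi => ?_))
    simpa using hi
  have hdisj : ∀ i (u v : V), i ∈ p u → i ∈ p v → u = v := by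
    intro i u v hu hv
    exact congrArg Sigma.fst (Finset.injOn_of_card_image_eq hcard
      (x₁ := ⟨u, i⟩) (x₂ := ⟨v, i⟩) (by simpa using hu) (by simpa using hv) rfl)
  have hval : ∀ i (u : V), i ∈ p u → superpose p i = u := by
    intro i u hu
    rw [superpose_apply, Finset.sum_eq_single u, if_pos hu]
    · exact fun v _ hvu => if_neg fun hv => hvu (hdisj i v u hv hu)
    · simp
  ext i
  simp only [Finset.mem_filter, Finset.mem_univ, true_and]
  refine ⟨hval i v, fun hi => ?_⟩
  have h0 : superpose p i ≠ 0 := fun h => hV (by rw [← h, hi]; exact v.2)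
  obtain ⟨u, -, hu⟩ := Finset.mem_biUnion.1 (support_superpose_subset p (by simpa using h0))
  have : u = v := Subtype.ext ((hval i u hu).symm.trans hi)
  exact this ▸ hu

theorem superpose_fibers (g : Fin n → Fin m →₀ ℕ) :
    superpose (fun v : (orbitType g).toFinset => Finset.univ.filter fun i => g i = v) = g := by
  ext1 i
  rw [superpose_apply]
  simp only [Finset.mem_filter, Finset.mem_univ, true_and]
  by_cases h : g i = 0
  · rw [h]
    exact Finset.sum_eq_zero fun v _ => by simp [eq_comm]
  · have hi : g i ∈ (orbitType g).toFinset := by simp [orbitType, h]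
    rw [Finset.sum_eq_single ⟨g i, hi⟩]
    · simp
    · exact fun v _ hv => if_neg fun h => hv (Subtype.ext h.symm)
    · simp

/-- Among the basis tensors with at least `|T|` nontrivial factors, those occurring in the product of
elementary symmetric tensors attached to `T` are the ones of type `T`, each with coefficient `1`. -/
theorem repr_prod_elemSym {T : Multiset (Fin m →₀ ℕ)} (hT : 0 ∉ T)
    {g : Fin n → Fin m →₀ ℕ} (hg : T.card ≤ (orbitType g).card) :
    (monomialBasis K n m).repr (∏ v ∈ T.toFinset, elemSym K n (T.count v) v) g =
      if orbitType g = T then 1 else 0 := by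
  have hsum : ∀ p ∈ Fintype.piFinset fun v : T.toFinset =>
      (Finset.univ : Finset (Fin n)).powersetCard (T.count (v : Fin m →₀ ℕ)),
      (∀ v, (p v).card = T.count (v : Fin m →₀ ℕ)) ∧ ∑ v, (p v).card = T.card := by
    intro p hp
    have h : ∀ v, (p v).card = T.count (v : Fin m →₀ ℕ) := fun v =>
      (Finset.mem_powersetCard.1 (Fintype.mem_piFinset.1 hp v)).2
    refine ⟨h, ?_⟩
    rw [Finset.sum_congr rfl fun v _ => h v, ← Multiset.toFinset_sum_count_eq T]
    exact Finset.sum_coe_sort T.toFinset fun v => T.count v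
  have hV : 0 ∉ T.toFinset := by simpa using hT
  rw [prod_elemSym, map_sum, Finsupp.finsetSum_apply]
  simp only [monomialBasis_repr_monomialTensor]
  split_ifs with h
  · subst h
    rw [Finset.sum_eq_single fun v : (orbitType g).toFinset =>
      Finset.univ.filter fun i => g i = v]
    · rw [if_pos (superpose_fibers g)]
    · intro p hp hne
      refine if_neg fun hpg => hne (funext fun v => ?_)
      rw [eq_fiber_of_le_card_orbitType (p := p) hV (by rw [(hsum p hp).2, hpg]) v, hpg]
    · intro hnot
      refine absurd (Fintype.mem_piFinset.2 fun v => ?_) hnot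
      rw [Finset.mem_powersetCard]
      exact ⟨Finset.subset_univ _, (count_orbitType g fun h => hV (h ▸ v.2)).symm⟩
  · refine Finset.sum_eq_zero fun p hp => if_neg fun hpg => h ?_
    obtain ⟨h₁, h₂⟩ := hsum p hp
    refine (Multiset.eq_of_le_of_card_le (Multiset.le_iff_count.2 fun v => ?_) ?_).symm
    · by_cases hv : v ∈ T
      · have hv' : v ∈ T.toFinset := by simpa using hv
        rw [count_orbitType g fun h => hT (h ▸ hv), ← h₁ ⟨v, hv'⟩,
          eq_fiber_of_le_card_orbitType (p := p) hV (by rw [h₂, hpg]; exact hg) ⟨v, hv'⟩, hpg]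
      · simp [Multiset.count_eq_zero_of_notMem hv]
    · rw [← hpg, ← h₂]
      exact card_orbitType_superpose_le p

/-- The elementary symmetric tensors of monomials generate `TS^n P`. The proof is by induction on a
strict bound `d` for the number of nontrivial factors of the basis tensors occurring. -/
theorem TS_le_of_elemSym_mem {B : Subalgebra K (⨂[K] _ : Fin n, P K m)} (hB : B ≤ TS K n (P K m))
    (hmem : ∀ k v, elemSym K n k v ∈ B) : TS K n (P K m) ≤ B := by
  classical
  suffices h : ∀ d : ℕ, ∀ z ∈ TS K n (P K m),
      (∀ g, (monomialBasis K n m).repr z g ≠ 0 → (orbitType g).card < d) → z ∈ B by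
    intro z hz
    refine h (((monomialBasis K n m).repr z).support.sup (fun g => (orbitType g).card) + 1) z hz
      fun g hg => Nat.lt_succ_of_le ?_
    exact Finset.le_sup (f := fun g => (orbitType g).card) (Finsupp.mem_support_iff.2 hg)
  intro d
  induction d with
  | zero =>
    intro z _ hd
    have : z = 0 := (monomialBasis K n m).ext_elem fun g => by
      by_contra h
      exact absurd (hd g (by simpa using h)) (Nat.not_lt_zero _)
    exact this ▸ B.zero_mem
  | succ d ih =>
    intro z hz hd
    set c := (monomialBasis K n m).repr z with hc
    have hfac : Function.FactorsThrough (fun g => c g) orbitType := by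
      intro f g hfg
      obtain ⟨σ, rfl⟩ := exists_perm_of_orbitType_eq hfg
      change c f = c (f ∘ σ)
      rw [hc, ← monomialBasis_repr_reindex, hz σ]
    -- `c'` assigns to a type the common coefficient of `z` on all basis tensors of that type.
    let c' : Multiset (Fin m →₀ ℕ) → K := Function.extend orbitType (fun g => c g) 0
    have hc' : ∀ g, c' (orbitType g) = c g := fun g => hfac.extend_apply 0 g
    let S : Finset (Multiset (Fin m →₀ ℕ)) :=
      (c.support.filter fun g => (orbitType g).card = d).image orbitType
    -- `b` agrees with `z` on all basis tensors with at least `d` nontrivial factors.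
    let b := ∑ T ∈ S, c' T • ∏ v ∈ T.toFinset, elemSym K n (T.count v) v
    have hbB : b ∈ B := B.sum_mem fun T _ =>
      B.smul_mem (B.prod_mem fun v _ => hmem _ _) _
    have hS : ∀ T ∈ S, 0 ∉ T ∧ T.card = d := by
      intro T hT
      obtain ⟨f, hf, rfl⟩ := Finset.mem_image.1 hT
      exact ⟨zero_notMem_orbitType f, (Finset.mem_filter.1 hf).2⟩
    have hb : ∀ g, d ≤ (orbitType g).card → (monomialBasis K n m).repr b g = c g := by
      intro g hg
      have e : (monomialBasis K n m).repr b g =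
          ∑ T ∈ S, if orbitType g = T then c' T else 0 := by
        simp only [b, map_sum, map_smul, Finsupp.finsetSum_apply, Finsupp.smul_apply, smul_eq_mul]
        refine Finset.sum_congr rfl fun T hT => ?_
        rw [repr_prod_elemSym (hS T hT).1 ((hS T hT).2.trans_le hg), mul_ite, mul_one, mul_zero]
      rw [e, Finset.sum_ite_eq, hc']
      split_ifs with h
      · rfl
      · by_contra hne
        refine h (Finset.mem_image_of_mem _ (Finset.mem_filter.2 ⟨?_, ?_⟩))
        · exact Finsupp.mem_support_iff.2 (Ne.symm hne)
        · exact le_antisymm (Nat.le_of_lt_succ (hd g (Ne.symm hne))) hg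
    rw [← sub_add_cancel z b]
    refine B.add_mem (ih _ (Subalgebra.sub_mem _ hz (hB hbB)) fun g hg => ?_) hbB
    by_contra hlt
    exact hg (by rw [map_sub, Finsupp.sub_apply, hb g (not_lt.1 hlt), sub_self])

end SymmetricTensors

/-! ### Permutation matrices and symmetry of the image -/

section Equivariance

variable {K : Type*} [CommRing K] {n m : ℕ}

/-- The permutation matrix with entry `1` at `(σ j, j)`, as an element of `GL(n, K)`. In Mathlib's
convention `σ.permMatrix` has its entries `1` at `(i, σ i)`, hence the inverse. -/
def permGL (K : Type*) [CommRing K] {n : ℕ} (σ : Equiv.Perm (Fin n)) : GL (Fin n) K where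
  val := σ⁻¹.permMatrix K
  inv := σ.permMatrix K
  val_inv := by rw [← Matrix.permMatrix_mul, mul_inv_cancel, Matrix.permMatrix_one]
  inv_val := by rw [← Matrix.permMatrix_mul, inv_mul_cancel, Matrix.permMatrix_one]

/-- Conjugation by a permutation matrix permutes the rows and columns of a generic matrix. -/
theorem conjGeneric_permGL (σ : Equiv.Perm (Fin n)) (k : Fin m) (i j : Fin n) :
    conjGeneric K n m (permGL K σ) k i j = MvPolynomial.X (k, σ i, σ j) := by
  have h : ∀ τ : Equiv.Perm (Fin n), (τ.permMatrix K).map (algebraMap K (A K n m)) =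
      τ.permMatrix (A K n m) := fun τ => by
    ext1 a b
    rw [Matrix.map_apply, Equiv.Perm.permMatrix, Equiv.Perm.permMatrix, PEquiv.toMatrix_apply,
      PEquiv.toMatrix_apply, apply_ite (algebraMap K (A K n m)), map_one, map_zero]
  change ((σ.permMatrix K).map (algebraMap K (A K n m)) * generic K n m k *
    (σ⁻¹.permMatrix K).map (algebraMap K (A K n m))) i j = _
  rw [h, h, Equiv.Perm.permMatrix, Equiv.Perm.permMatrix, PEquiv.toMatrix_toPEquiv_mul,
    PEquiv.mul_toMatrix_toPEquiv]
  rfl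

/-- Permutation of the factors of `B^{⊗ n}`, as an algebra homomorphism. -/
def reindexAlgHom (K : Type*) [CommRing K] {n : ℕ} (B : Type*) [CommRing B] [Algebra K B]
    (σ : Equiv.Perm (Fin n)) : (⨂[K] _ : Fin n, B) →ₐ[K] ⨂[K] _ : Fin n, B :=
  AlgHom.ofLinearMap (PiTensorProduct.reindex K (fun _ => B) σ).toLinearMap
    (PiTensorProduct.reindex_tprod _ _) (reindex_mul K n B σ)

theorem reindexAlgHom_singleAlgHom {B : Type*} [CommRing B] [Algebra K B]
    (σ : Equiv.Perm (Fin n)) (i : Fin n) (b : B) :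
    reindexAlgHom K B σ (PiTensorProduct.singleAlgHom (R := K) (A := fun _ => B) i b) =
      PiTensorProduct.singleAlgHom (R := K) (A := fun _ => B) (σ i) b := by
  refine (PiTensorProduct.reindex_tprod σ _).trans ?_
  change _ = PiTensorProduct.tprod K _
  congr 1
  ext1 j
  change (Pi.mulSingle i b : Fin n → B) (σ.symm j) = (Pi.mulSingle (σ i) b : Fin n → B) j
  simp [Pi.mulSingle_apply, Equiv.symm_apply_eq]

/-- The composite `A → D → P^{⊗ n}` is equivariant for the symmetric group, acting on `A` through
permutation matrices. -/
theorem toTensor_diag_act_permGL (σ : Equiv.Perm (Fin n)) (a : A K n m) :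
    toTensor K n m (diag K n m (act K n m (permGL K σ) a)) =
      PiTensorProduct.reindex K (fun _ => P K m) σ (toTensor K n m (diag K n m a)) := by
  suffices h : ((toTensor K n m).comp (diag K n m)).comp (act K n m (permGL K σ)) =
      (reindexAlgHom K (P K m) σ).comp ((toTensor K n m).comp (diag K n m)) from
    AlgHom.congr_fun h a
  refine MvPolynomial.algHom_ext fun ⟨k, i, j⟩ => ?_
  simp only [AlgHom.comp_apply, act, diag, toTensor, MvPolynomial.aeval_X, conjGeneric_permGL]
  by_cases h : i = j
  · subst h
    rw [if_pos rfl, if_pos rfl, MvPolynomial.aeval_X, MvPolynomial.aeval_X,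
      reindexAlgHom_singleAlgHom]
  · simp [h]

theorem diagP_mk (a : A K n m) :
    diagP K n m (Ideal.Quotient.mk (commIdeal K n m) a) = diag K n m a := rfl

theorem toTensor_diag_mem_TS {a : A K n m} (ha : a ∈ invA K n m) :
    toTensor K n m (diag K n m a) ∈ TS K n (P K m) := fun σ => by
  have : act K n m (permGL K σ) a = a := (Algebra.mem_iInf.1 ha) (permGL K σ)
  rw [← toTensor_diag_act_permGL, this]

theorem toTensor_diagP_mem_TS {a : AP K n m} (ha : a ∈ invAP K n m) :
    toTensor K n m (diagP K n m a) ∈ TS K n (P K m) := fun σ => by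
  have h : actP K n m (permGL K σ) a = a := (Algebra.mem_iInf.1 ha) (permGL K σ)
  obtain ⟨a, rfl⟩ := Ideal.Quotient.mk_surjective a
  have h' : actP K n m (permGL K σ) (Ideal.Quotient.mk (commIdeal K n m) a) =
    Ideal.Quotient.mk (commIdeal K n m) (act K n m (permGL K σ) a) := rfl
  rw [diagP_mk, ← toTensor_diag_act_permGL, ← diagP_mk, ← h', h, diagP_mk]

theorem mk_mem_invAP {a : A K n m} (ha : a ∈ invA K n m) :
    Ideal.Quotient.mk (commIdeal K n m) a ∈ invAP K n m := by
  refine Algebra.mem_iInf.2 fun g => ?_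
  have : act K n m g a = a := (Algebra.mem_iInf.1 ha) g
  exact congrArg (Ideal.Quotient.mk (commIdeal K n m)) this

end Equivariance

/-! ### Characteristic polynomials of monomials in the generic matrices -/

section CharPoly

variable {K : Type*} [CommRing K] {n m : ℕ}

/-- The ordered product `ξ_1^{v_1} ⋯ ξ_m^{v_m}`, the value of the monomial `y^v` at the generic
matrices; these do not commute over `A`, so an order is fixed. -/
def genericMonomial (K : Type*) [CommRing K] (n : ℕ) {m : ℕ} (v : Fin m →₀ ℕ) :
    Matrix (Fin n) (Fin n) (A K n m) :=
  (List.ofFn fun k => generic K n m k ^ v k).prod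

/-- The action of `g` maps a monomial in the generic matrices to its conjugate, which has the same
characteristic polynomial. The sign spares the signs in `toTensor_diag_charpoly_coeff`. -/
theorem charpoly_coeff_mem_invA (v : Fin m →₀ ℕ) (k : ℕ) :
    (-genericMonomial K n v).charpoly.coeff k ∈ invA K n m := by
  refine Algebra.mem_iInf.2 fun g => ?_
  change act K n m g _ = _
  let φ : Matrix (Fin n) (Fin n) (A K n m) →+* Matrix (Fin n) (Fin n) (A K n m) :=
    (act K n m g).toRingHom.mapMatrix
  let u : (Matrix (Fin n) (Fin n) (A K n m))ˣ :=
    Units.map (algebraMap K (A K n m)).mapMatrix.toMonoidHom g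
  -- Being carried by `φ` to the conjugate under `u` is preserved by products.
  have hgen : ∀ h, SemiconjBy u.val
      (φ (generic K n m h)) (generic K n m h) := fun h => by
    have e : φ (generic K n m h) = (u⁻¹).val * generic K n m h * u.val := map_act_generic K n m g h
    rw [e, SemiconjBy, ← mul_assoc, ← mul_assoc, Units.mul_inv, one_mul]
  have hprod : ∀ l : List (Matrix (Fin n) (Fin n) (A K n m)),
      (∀ x ∈ l, SemiconjBy u.val (φ x) x) →
      SemiconjBy u.val (φ l.prod) l.prod := by
    intro l hl
    induction l with
    | nil => simp
    | cons x l ih =>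
      rw [List.prod_cons, map_mul]
      exact (hl x (by simp)).mul_right (ih fun y hy => hl y (by simp [hy]))
  have hmon : SemiconjBy u.val
      (φ (-genericMonomial K n v)) (-genericMonomial K n v) := by
    rw [map_neg]
    refine SemiconjBy.neg_right (hprod _ fun x hx => ?_)
    obtain ⟨h, rfl⟩ := (List.mem_ofFn' _ _).1 hx
    rw [map_pow]
    exact (hgen h).pow_right _
  have hconj : φ (-genericMonomial K n v) = (u⁻¹).val * (-genericMonomial K n v) * u.val := by
    rw [mul_assoc, ← hmon.eq, ← mul_assoc, Units.inv_mul, one_mul]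
  have hchar : (-genericMonomial K n v).charpoly.map (act K n m g).toRingHom =
      (-genericMonomial K n v).charpoly := by
    rw [← Matrix.charpoly_map, ← RingHom.mapMatrix_apply]
    change (φ (-genericMonomial K n v)).charpoly = _
    rw [hconj, Matrix.charpoly_mul_comm, ← mul_assoc, Units.mul_inv, one_mul]
  have hcoeff := congrArg (fun q => q.coeff k) hchar
  rwa [Polynomial.coeff_map] at hcoeff

theorem map_diag_genericMonomial (v : Fin m →₀ ℕ) :
    (genericMonomial K n v).map (diag K n m) =
      Matrix.diagonal fun i => ∏ k, (MvPolynomial.X (i, k) : D K n m) ^ v k := by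
  have hgen : ∀ k, (diag K n m).toRingHom.mapMatrix (generic K n m k) =
      Matrix.diagonalRingHom (Fin n) (D K n m) fun i => MvPolynomial.X (i, k) := by
    intro k
    ext1 i j
    simp [generic, diag, Matrix.diagonal_apply]
  change (diag K n m).toRingHom.mapMatrix (genericMonomial K n v) = _
  rw [genericMonomial, map_list_prod, List.map_ofFn]
  simp only [Function.comp_def, map_pow, hgen]
  simp only [← map_pow]
  rw [← Function.comp_def (Matrix.diagonalRingHom (Fin n) (D K n m)), ← List.map_ofFn,
    ← map_list_prod, List.prod_ofFn]
  change Matrix.diagonal _ = _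
  congr 1
  ext1 i
  rw [Finset.prod_apply]
  rfl

theorem toTensor_prod_X_pow (v : Fin m →₀ ℕ) (i : Fin n) :
    toTensor K n m (∏ k, MvPolynomial.X (i, k) ^ v k) =
      PiTensorProduct.singleAlgHom (R := K) (A := fun _ : Fin n => P K m) i
        (MvPolynomial.monomial v 1) := by
  rw [MvPolynomial.monomial_eq, MvPolynomial.C_1, one_mul, Finsupp.prod_fintype _ _ (by simp)]
  simp only [toTensor, map_prod, map_pow, MvPolynomial.aeval_X]

theorem prod_singleAlgHom_monomial (v : Fin m →₀ ℕ) (s : Finset (Fin n)) :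
    ∏ i ∈ s, PiTensorProduct.singleAlgHom (R := K) (A := fun _ : Fin n => P K m) i
        (MvPolynomial.monomial v 1) =
      monomialTensor K fun i => if i ∈ s then v else 0 := by
  have h : ∀ i, PiTensorProduct.singleAlgHom (R := K) (A := fun _ : Fin n => P K m) i
      (MvPolynomial.monomial v 1) = monomialTensor K fun j => if j = i then v else 0 := fun i => by
    change PiTensorProduct.tprod K (Pi.mulSingle (M := fun _ : Fin n => P K m) i _) =
      PiTensorProduct.tprod K _
    congr 1
    ext1 j
    simp only [Pi.mulSingle_apply]
    split_ifs <;> rfl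
  simp only [h]
  rw [prod_monomialTensor]
  congr 1
  ext1 i
  rw [Finset.sum_apply, Finset.sum_ite_eq]

/-- On diagonal matrices the characteristic polynomial of `-y^v(ξ)` becomes the product of the
`X + (y^v)_i`, with `(y^v)_i` the copy of `y^v` in position `i`. -/
theorem toTensor_diag_charpoly_coeff (v : Fin m →₀ ℕ) {k : ℕ} (hk : k ≤ n) :
    toTensor K n m (diag K n m ((-genericMonomial K n v).charpoly.coeff (n - k))) =
      elemSym K n k v := by
  have h₁ : (-genericMonomial K n v).charpoly.map (diag K n m).toRingHom =
      ∏ i, (Polynomial.X + Polynomial.C (∏ k, (MvPolynomial.X (i, k) : D K n m) ^ v k)) := by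
    rw [← Matrix.charpoly_map]
    have : (-genericMonomial K n v).map (diag K n m).toRingHom =
        Matrix.diagonal fun i => -∏ k, (MvPolynomial.X (i, k) : D K n m) ^ v k := by
      rw [← Matrix.diagonal_neg, ← map_diag_genericMonomial]
      ext1 i j
      simp
    rw [this, Matrix.charpoly_diagonal]
    simp
  have h₂ := congrArg (Polynomial.coeff · (n - k)) h₁
  simp only [Polynomial.coeff_map] at h₂
  rw [Finset.prod_X_add_C_coeff _ _ (by simp), Finset.card_univ, Fintype.card_fin,
    Nat.sub_sub_self hk] at h₂
  change toTensor K n m ((diag K n m).toRingHom _) = _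
  rw [h₂, map_sum, elemSym]
  refine Finset.sum_congr rfl fun s _ => ?_
  rw [map_prod, ← prod_singleAlgHom_monomial]
  exact Finset.prod_congr rfl fun i _ => toTensor_prod_X_pow v i

theorem elemSym_eq_zero {k : ℕ} (hk : n < k) (v : Fin m →₀ ℕ) : elemSym K n k v = 0 := by
  rw [elemSym, Finset.powersetCard_eq_empty.2 (by simpa using hk), Finset.sum_empty]

/-- Every symmetric tensor over `P` is the image of an invariant in `A`. -/
theorem exists_invA_toTensor_diag_eq {w : ⨂[K] _ : Fin n, P K m} (hw : w ∈ TS K n (P K m)) :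
    ∃ a ∈ invA K n m, toTensor K n m (diag K n m a) = w := by
  let B := (invA K n m).map ((toTensor K n m).comp (diag K n m))
  have hB : B ≤ TS K n (P K m) := by
    rintro _ ⟨a, ha, rfl⟩
    exact toTensor_diag_mem_TS ha
  refine TS_le_of_elemSym_mem hB (fun k v => ?_) hw
  rcases le_or_gt k n with hk | hk
  · exact ⟨_, charpoly_coeff_mem_invA v (n - k), toTensor_diag_charpoly_coeff v hk⟩
  · rw [elemSym_eq_zero hk]
    exact B.zero_mem

end CharPoly

/-! ### Functoriality of symmetric tensors and the surjections -/

/-- The algebra homomorphism `f^{⊗ n} : B^{⊗ n} → C^{⊗ n}`. -/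
def mapAlgHom {K : Type*} [CommRing K] (n : ℕ) {B C : Type*} [CommRing B] [Algebra K B]
    [CommRing C] [Algebra K C] (f : B →ₐ[K] C) :
    (⨂[K] _ : Fin n, B) →ₐ[K] ⨂[K] _ : Fin n, C :=
  AlgHom.ofLinearMap (PiTensorProduct.map fun _ => f.toLinearMap)
    (by
      rw [PiTensorProduct.one_def, PiTensorProduct.map_tprod, PiTensorProduct.one_def]
      congr 1
      ext1 i
      exact map_one f)
    (LinearMap.map_mul_iff _ |>.mpr <| by
      ext x y
      simp [Pi.mul_def])

theorem map_mem_TS {K : Type*} [CommRing K] {n : ℕ} {B C : Type*} [CommRing B] [Algebra K B]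
    [CommRing C] [Algebra K C] (f : B →ₐ[K] C) {w : ⨂[K] _ : Fin n, B} (hw : w ∈ TS K n B) :
    mapAlgHom n f w ∈ TS K n C := fun σ =>
  (PiTensorProduct.map_reindex (fun _ => f.toLinearMap) σ w).symm.trans
    (congrArg (mapAlgHom n f) (hw σ))

end GenericMatrices

end
theorem mainTheorem3 {K : Type*} [CommRing K] (n m : ℕ) {R : Type*} [CommRing R] [Algebra K R]
    (I : Ideal (GenericMatrices.P K m))
    (e : (GenericMatrices.P K m ⧸ I) ≃ₐ[K] R) (hflat : Module.Flat K R) :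
    ∃ (Φ : GenericMatrices.invA K n m →ₐ[K] GenericMatrices.TS K n R)
      (Φ' : GenericMatrices.invAP K n m →ₐ[K] GenericMatrices.TS K n R),
      Function.Surjective Φ ∧ Function.Surjective Φ' ∧
      (∀ a : GenericMatrices.invA K n m, (Φ a : ⨂[K] _ : Fin n, R) =
        PiTensorProduct.map
          (fun _ : Fin n => (e.toAlgHom.comp (Ideal.Quotient.mkₐ K I)).toLinearMap)
          (GenericMatrices.toTensor K n m (GenericMatrices.diag K n m a))) ∧
      (∀ a : GenericMatrices.invAP K n m, (Φ' a : ⨂[K] _ : Fin n, R) =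
        PiTensorProduct.map
          (fun _ : Fin n => (e.toAlgHom.comp (Ideal.Quotient.mkₐ K I)).toLinearMap)
          (GenericMatrices.toTensor K n m (GenericMatrices.diagP K n m a))) := by
  open GenericMatrices in
  set π := e.toAlgHom.comp (Ideal.Quotient.mkₐ K I)
  have hsurj : Function.Surjective π.toLinearMap :=
    e.surjective.comp (Ideal.Quotient.mkₐ_surjective K I)
  have hlift : ∀ z : TS K n R, ∃ a ∈ invA K n m,
      mapAlgHom n π (toTensor K n m (diag K n m a)) = z := by
    rintro ⟨z, hz⟩
    obtain ⟨w, hw, hwz⟩ := exists_symmetric_lift hsurj hz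
    obtain ⟨a, ha, haw⟩ := exists_invA_toTensor_diag_eq hw
    exact ⟨a, ha, by rw [haw]; exact hwz⟩
  refine ⟨(((mapAlgHom n π).comp ((toTensor K n m).comp (diag K n m))).comp
      (invA K n m).val).codRestrict (TS K n R) fun a => map_mem_TS π (toTensor_diag_mem_TS a.2),
    (((mapAlgHom n π).comp ((toTensor K n m).comp (diagP K n m))).comp
      (invAP K n m).val).codRestrict (TS K n R) fun a => map_mem_TS π (toTensor_diagP_mem_TS a.2),
    fun z => ?_, fun z => ?_, fun _ => rfl, fun _ => rfl⟩
  · obtain ⟨a, ha, haz⟩ := hlift z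
    exact ⟨⟨a, ha⟩, Subtype.ext haz⟩
  · obtain ⟨a, ha, haz⟩ := hlift z
    exact ⟨⟨Ideal.Quotient.mk _ a, mk_mem_invAP ha⟩, Subtype.ext haz⟩
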